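/- Let $n$ be a positive even integer and $d=2^n$. Let $H=\frac1{\sqrt2}\begin{pmatrix}1&1\\1&-1\end{pmatrix}$, $\sigma_x=\begin{pmatrix}0&1\\1&0\end{pmatrix}$ and $K=(\mathbb I+i\sigma_x)/\sqrt2$, and let $U_1=\mathbb I^{\otimes n}$, $U_2=H^{\otimes n}$, $U_3=K^{\otimes n}$, acting on $n$ qubits with computational basis $\{|k\rangle : k\in\{0,1\}^n\}$. Let $(p_1,p_2,p_3)$ be a probability distribution and consider the ensemble $\mathcal E=\{p_t\frac1d,\;U_t|k\rangle\langle k|U_t^\dagger\}$, $t\in\{1,2,3\}$, $k\in\{0,1\}^n$. For a POVM $M=\{E_i\}$ with finitely many outcomes, let $\mathcal I(M)=H(A)+H(B)-H(AB)$ be the mutual information (Shannon entropies $H$ with logarithms to base $2$) between the label $A=(t,k)$ and the outcome $B=i$, whose joint distribution is $P_{AB}((t,k),i)=\frac{p_t}{d}\operatorname{Tr}(E_iU_t|k\rangle\langle k|U_t^\dagger)$. The accessible information is $\mathcal I_{acc}(\mathcal E)=\max_M\mathcal I(M)$. The maximum exists, and the following hold. 1. If $p_1,p_2,p_3\le\frac12$,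 then $\mathcal I_{acc}(\mathcal E)=\frac n2$. The maximum is achieved by the Bell-basis measurement $\{|\Gamma_i\rangle\langle\Gamma_i|\}_{i\in\{0,1\}^n}$, where $|\Gamma_i\rangle=|\Gamma_{i_1i_2}\rangle\otimes\cdots\otimes|\Gamma_{i_{n-1}i_n}\rangle$ and $|\Gamma_{00}\rangle=(|00\rangle+|11\rangle)/\sqrt2$, $|\Gamma_{01}\rangle=(|00\rangle-|11\rangle)/\sqrt2$, $|\Gamma_{10}\rangle=(|01\rangle+|10\rangle)/\sqrt2$, $|\Gamma_{11}\rangle=(|01\rangle-|10\rangle)/\sqrt2$. 2. If $p_t>\frac12$ for some $t\in\{1,2,3\}$, then $\mathcal I_{acc}(\mathcal E)>\frac n2$. -/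

import Mathlib

open scoped ComplexOrder

noncomputable section

namespace Locking

/-- Shannon entropy in bits of a finite distribution, `-∑ q log₂ q`, with `0 log 0 = 0`. -/
def shannonEntropy {α : Type*} [Fintype α] (q : α → ℝ) : ℝ :=
  -∑ a, q a * Real.logb 2 (q a)

/-- A POVM with finitely many outcomes: positive semidefinite effects that sum to the identity. -/
structure IsPOVM {ι H : Type*} [Fintype ι] [DecidableEq H] (E : ι → Matrix H H ℂ) : Prop where
  posSemidef : ∀ i, (E i).PosSemidef
  sum_eq_one : ∑ i, E i = 1

/-- Joint distribution of the label `x` (prior `p`) and of the outcome `i` of the measurement `E`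
on the state `ρ x`: the probability is `p x * tr (E i * ρ x)`. -/
def jointDist {X ι H : Type*} [Fintype H]
    (p : X → ℝ) (ρ : X → Matrix H H ℂ) (E : ι → Matrix H H ℂ) : X × ι → ℝ :=
  fun a => p a.1 * (Matrix.trace (E a.2 * ρ a.1)).re

/-- Mutual information `H(A) + H(B) - H(AB)` of a finite joint distribution, in bits. -/
def mutualInfo {X ι : Type*} [Fintype X] [Fintype ι] (P : X × ι → ℝ) : ℝ :=
  shannonEntropy (fun x => ∑ i, P (x, i)) + shannonEntropy (fun i => ∑ x, P (x, i))
    - shannonEntropy P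

/-- The values of the mutual information between the label of the ensemble `{p x, ρ x}` and the
outcome of a POVM, over all POVMs with finitely many outcomes. -/
def attainableInfo {X H : Type*} [Fintype X] [Fintype H] [DecidableEq H]
    (p : X → ℝ) (ρ : X → Matrix H H ℂ) : Set ℝ :=
  {v | ∃ (m : ℕ) (E : Fin m → Matrix H H ℂ), IsPOVM E ∧ mutualInfo (jointDist p ρ E) = v}

/-- Accessible information of the ensemble `{p x, ρ x}`. -/
def accessibleInfo {X H : Type*} [Fintype X] [Fintype H] [DecidableEq H]
    (p : X → ℝ) (ρ : X → Matrix H H ℂ) : ℝ :=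
  sSup (attainableInfo p ρ)

/-- Bit strings of length `n`: they label the computational basis of `n` qubits. -/
abbrev Bits (n : ℕ) : Type := Fin n → Fin 2

/-- The `n`-fold tensor power of a one-qubit matrix, in the computational basis. -/
def tensorPow (n : ℕ) (U : Matrix (Fin 2) (Fin 2) ℂ) : Matrix (Bits n) (Bits n) ℂ :=
  Matrix.of fun x y => ∏ l, U (x l) (y l)

/-- The Pauli matrix `σ_x`. -/
def pauliX : Matrix (Fin 2) (Fin 2) ℂ := !![0, 1; 1, 0]

/-- The Hadamard matrix. -/
def hadamard : Matrix (Fin 2) (Fin 2) ℂ := ((Real.sqrt 2 : ℝ) : ℂ)⁻¹ • !![1, 1; 1, -1]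

/-- `K = (I + i σ_x) / √2`. -/
def kMatrix : Matrix (Fin 2) (Fin 2) ℂ := ((Real.sqrt 2 : ℝ) : ℂ)⁻¹ • (1 + Complex.I • pauliX)

/-- The three unitaries `I^{⊗n}`, `H^{⊗n}`, `K^{⊗n}`. -/
def basisUnitary (n : ℕ) : Fin 3 → Matrix (Bits n) (Bits n) ℂ :=
  ![tensorPow n 1, tensorPow n hadamard, tensorPow n kMatrix]

/-- The prior `p_t / d` with `d = 2 ^ n` on pairs `(t, k)`. -/
def ensemblePrior (n : ℕ) (p : Fin 3 → ℝ) : Fin 3 × Bits n → ℝ :=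
  fun a => p a.1 * (1 / 2 ^ n)

/-- The state `U_t |k⟩⟨k| U_t†`. -/
def ensembleState (n : ℕ) : Fin 3 × Bits n → Matrix (Bits n) (Bits n) ℂ :=
  fun a => basisUnitary n a.1 * Matrix.single a.2 a.2 1 * (basisUnitary n a.1).conjTranspose

/-- The Bell vectors: `bell a b x y` is the coefficient of `|x y⟩` in `Γ_{ab}`, where
`Γ_{00} = (|00⟩ + |11⟩)/√2`, `Γ_{01} = (|00⟩ - |11⟩)/√2`,
`Γ_{10} = (|01⟩ + |10⟩)/√2`, `Γ_{11} = (|01⟩ - |10⟩)/√2`. -/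
def bell (a b : Fin 2) : Matrix (Fin 2) (Fin 2) ℂ :=
  ((Real.sqrt 2 : ℝ) : ℂ)⁻¹ •
    (![![!![1, 0; 0, 1], !![1, 0; 0, -1]], ![!![0, 1; 1, 0], !![0, 1; -1, 0]]] :
      Fin 2 → Fin 2 → Matrix (Fin 2) (Fin 2) ℂ) a b

/-- The product vector `Γ_{i₁i₂} ⊗ Γ_{i₃i₄} ⊗ ⋯ ⊗ Γ_{iₙ₋₁iₙ}` (for even `n`). -/
def bellVector (n : ℕ) (i : Bits n) : Bits n → ℂ :=
  fun x => ∏ j : Fin (n / 2),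
    bell (i ⟨2 * j, by omega⟩) (i ⟨2 * j + 1, by omega⟩)
      (x ⟨2 * j, by omega⟩) (x ⟨2 * j + 1, by omega⟩)

/-- The Bell-basis measurement `{|Γ_i⟩⟨Γ_i|}`. -/
def bellMeasurement (n : ℕ) : Bits n → Matrix (Bits n) (Bits n) ℂ :=
  fun i => Matrix.vecMulVec (bellVector n i) (star (bellVector n i))

end Locking

end

namespace Locking
open Real

/-! In every basis `t` the weights of an effect sum to its trace. The outcome is therefore
independent of `t`, and the information is `n` bits minus an average, over outcomes and over `t`
with weights `p t`, of the entropy of the weights in basis `t`. By superadditivity of `massEntropy`,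
splitting effects into rank-one pieces loses nothing, so the information is at most `n` minus the
least average entropy of a unit vector. Pauli operators permute each of the three bases, and the
Pauli orbit of a minimiser, rescaled, is a POVM that attains this bound
(`exists_isGreatest_attainableInfo`).

It remains to estimate the minimum. The bases are the `n`-fold products of the eigenbases of the
three Pauli matrices, and the entropies in any two of them sum to at least `n` bits
(`entropicUncertainty_basisUnitary`). This follows from a one-qubit inequality and additivity under
tensor products. If every `p t ≤ 1/2`, combining the three pairs bounds the average below by `n /
2`; Bell vectors, uniform on `2 ^ (n / 2)` outcomes in each basis, attain it. If `p t > 1/2`, a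
vector of basis `t` has average at most `(1 - p t) * n < n / 2`. -/

/-- The Shannon entropy in nats of a finite nonnegative function, scaled by its total mass. -/
noncomputable def massEntropy {α : Type*} [Fintype α] (q : α → ℝ) : ℝ :=
  ∑ a, negMulLog (q a) - negMulLog (∑ a, q a)

/-! ### Entropy of unnormalised finite distributions -/

section massEntropy
variable {α β : Type*} [Fintype α] [Fintype β]

/-- Homogeneity of degree one is what lets vectors and effects stay unnormalised below. -/
lemma massEntropy_const_mul (c : ℝ) (q : α → ℝ) :
    massEntropy (fun a => c * q a) = c * massEntropy q := by
  simp only [massEntropy, negMulLog_mul, Finset.sum_add_distrib, ← Finset.sum_mul,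
    ← Finset.mul_sum]
  ring

lemma massEntropy_comp_equiv (e : β ≃ α) (q : α → ℝ) :
    massEntropy (fun b => q (e b)) = massEntropy q := by
  simp only [massEntropy]
  rw [e.sum_comp q, e.sum_comp (fun a => negMulLog (q a))]

/-- Chain rule: the marginal's `negMulLog` terms cancel against the masses of the rows. -/
lemma massEntropy_prod (q : α × β → ℝ) :
    massEntropy q =
      massEntropy (fun a => ∑ b, q (a, b)) + ∑ a, massEntropy (fun b => q (a, b)) := by
  simp only [massEntropy, Fintype.sum_prod_type, Finset.sum_sub_distrib]
  ring

lemma massEntropy_prod_right (q : α × β → ℝ) :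
    massEntropy q =
      massEntropy (fun b => ∑ a, q (a, b)) + ∑ b, massEntropy (fun a => q (a, b)) := by
  rw [← massEntropy_comp_equiv (Equiv.prodComm β α) q, massEntropy_prod]
  rfl

/-- Pointwise Gibbs inequality, from `log x ≤ x - 1`; summed over a table with margins `a`, `b` and
total `s`, it says that mutual information is nonnegative. -/
lemma mul_log_sub_log_le {q a b s : ℝ} (hq : 0 ≤ q) (hqa : q ≤ a) (hqb : q ≤ b) (hbs : b ≤ s) :
    q * (log a + log b - log q - log s) ≤ a * b / s - q := by
  rcases hq.eq_or_lt with rfl | hq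
  · have : 0 ≤ a * b / s := div_nonneg (mul_nonneg hqa hqb) (hqb.trans hbs)
    simpa using this
  have ha := hq.trans_le hqa
  have hb := hq.trans_le hqb
  have hs := hb.trans_le hbs
  have h : log a + log b - log q - log s = log (a * b / (q * s)) := by
    rw [log_div (by positivity) (by positivity), log_mul ha.ne' hb.ne', log_mul hq.ne' hs.ne']
    ring
  have h1 := log_le_sub_one_of_pos (x := a * b / (q * s)) (by positivity)
  rw [h]
  calc q * log (a * b / (q * s)) ≤ q * (a * b / (q * s) - 1) := by gcongr
    _ = a * b / s - q := by field_simp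

/-- Conditioning does not increase the entropy: `massEntropy` is superadditive. -/
lemma sum_massEntropy_le {q : β → α → ℝ} (hq : ∀ b a, 0 ≤ q b a) :
    ∑ b, massEntropy (q b) ≤ massEntropy (fun a => ∑ b, q b a) := by
  have hrow : ∀ b a, q b a ≤ ∑ a, q b a := fun b a =>
    Finset.single_le_sum (fun a _ => hq b a) (Finset.mem_univ a)
  have hcol : ∀ b a, q b a ≤ ∑ b, q b a := fun b a =>
    Finset.single_le_sum (f := fun b => q b a) (fun b _ => hq b a) (Finset.mem_univ b)
  have htot : ∀ a, ∑ b, q b a ≤ ∑ a, ∑ b, q b a := fun a =>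
    Finset.single_le_sum (f := fun a => ∑ b, q b a)
      (fun a _ => Finset.sum_nonneg fun b _ => hq b a) (Finset.mem_univ a)
  have key : ∑ b, ∑ a, q b a * (log (∑ a, q b a) + log (∑ b, q b a) - log (q b a)
      - log (∑ a, ∑ b, q b a)) ≤
      ∑ b, ∑ a, ((∑ a, q b a) * (∑ b, q b a) / (∑ a, ∑ b, q b a) - q b a) :=
    Finset.sum_le_sum fun b _ => Finset.sum_le_sum fun a _ =>
      mul_log_sub_log_le (hq b a) (hrow b a) (hcol b a) (htot a)
  -- Both terms sum to the total mass `s`; `s * s / s = s` also holds for `s = 0`.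
  have hr : ∑ b, ∑ a, ((∑ a, q b a) * (∑ b, q b a) / (∑ a, ∑ b, q b a) - q b a) = 0 := by
    simp only [Finset.sum_sub_distrib, ← Finset.sum_div, ← Finset.mul_sum, ← Finset.sum_mul]
    rw [Finset.sum_comm (f := fun b a => q b a), mul_self_div_self, sub_self]
  have hl : ∑ b, ∑ a, q b a * (log (∑ a, q b a) + log (∑ b, q b a) - log (q b a)
      - log (∑ a, ∑ b, q b a)) =
      ∑ b, massEntropy (q b) - massEntropy (fun a => ∑ b, q b a) := by
    simp only [massEntropy, negMulLog, mul_sub, mul_add, Finset.sum_sub_distrib,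
      Finset.sum_add_distrib, ← Finset.sum_mul, neg_mul, Finset.sum_neg_distrib]
    rw [Finset.sum_comm (f := fun b a => q b a * log (∑ b, q b a)),
      Finset.sum_comm (f := fun b a => q b a)]
    simp only [← Finset.sum_mul]
    ring
  linarith

/-- The uniform distribution has the largest entropy. -/
lemma massEntropy_le_log_card [Nonempty α] {q : α → ℝ} (hq : ∀ a, 0 ≤ q a)
    (hsum : ∑ a, q a = 1) : massEntropy q ≤ log (Fintype.card α) := by
  have hc : (0 : ℝ) < Fintype.card α := by exact_mod_cast Fintype.card_pos
  have h := concaveOn_negMulLog.le_map_sum (t := Finset.univ)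
    (w := fun _ : α => (Fintype.card α : ℝ)⁻¹)
    (p := q) (fun _ _ => by positivity) (by simp [hc.ne']) (fun a _ => hq a)
  simp only [smul_eq_mul, ← Finset.mul_sum, hsum, mul_one] at h
  rw [inv_mul_le_iff₀ hc] at h
  simpa [massEntropy, hsum, negMulLog, hc.ne'] using h

lemma massEntropy_of_flat {q : α → ℝ} {c : ℝ} (hq : ∀ a, q a = 0 ∨ q a = c)
    (hsum : ∑ a, q a = 1) : massEntropy q = -log c := by
  have h : ∀ a, negMulLog (q a) = q a * -log c := fun a => by
    rcases hq a with h | h <;> simp [h, negMulLog]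
  simp only [massEntropy, h, ← Finset.sum_mul, hsum]
  simp

lemma massEntropy_nonneg {q : α → ℝ} (hq : ∀ a, 0 ≤ q a) : 0 ≤ massEntropy q := by
  have h : ∀ a, q a * log (q a) ≤ q a * log (∑ a, q a) := fun a => by
    rcases (hq a).eq_or_lt with h | h
    · simp [← h]
    · exact mul_le_mul_of_nonneg_left (log_le_log h
        (Finset.single_le_sum (fun a _ => hq a) (Finset.mem_univ a))) h.le
  have := Finset.sum_le_sum fun a (_ : a ∈ Finset.univ) => h a
  rw [← Finset.sum_mul] at this
  simp only [massEntropy, negMulLog, neg_mul, Finset.sum_neg_distrib]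
  linarith

lemma continuous_massEntropy : Continuous (massEntropy : (α → ℝ) → ℝ) := by
  unfold massEntropy
  fun_prop

end massEntropy

/-! ### The parabola bound for the binary entropy -/

/-- The power series of `(log (1 + x) - log (1 - x)) / x` has only even powers and positive
coefficients, so this quotient increases on `(0, 1)`. -/
lemma log_add_sub_log_sub_le {c d : ℝ} (hc : 0 < c) (hcd : c ≤ d) (hd : d < 1) :
    log (1 + c) - log (1 - c) ≤ c / d * (log (1 + d) - log (1 - d)) := by
  have h0 := hc.trans_le hcd
  have h1 := hasSum_log_sub_log_of_abs_lt_one (x := c) (by rw [abs_of_pos hc]; linarith)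
  have h2 := (hasSum_log_sub_log_of_abs_lt_one (x := d) (by rwa [abs_of_pos h0])).mul_left (c / d)
  refine hasSum_le (fun k => ?_) h1 h2
  have : c ^ (2 * k) ≤ d ^ (2 * k) := by gcongr
  calc _ = 2 * (1 / (2 * k + 1 : ℝ)) * c * c ^ (2 * k) := by ring
    _ ≤ 2 * (1 / (2 * k + 1 : ℝ)) * c * d ^ (2 * k) := by gcongr
    _ = _ := by field_simp; ring

lemma parabola_le_binEntropy_of_nonneg {y : ℝ} (h0 : 0 ≤ y) (h1 : y ≤ 1) :
    2 * log 2 * (1 - y ^ 2) ≤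
      2 * log 2 + negMulLog (1 + y) + negMulLog (1 - y) := by
  set f : ℝ → ℝ := fun y => 2 * log 2 * y ^ 2 + negMulLog (1 + y) + negMulLog (1 - y) with hf
  suffices h : 0 ≤ f y by simp only [hf] at h; linarith
  have hf0 : f 0 = 0 := by simp [hf]
  have hf1 : f 1 = 0 := by simp [hf, negMulLog]; norm_num
  -- Since `f` vanishes at 0 and 1, a negative value at `y` yields `c < y < d` with `f' c < 0 < f'
  -- d`. But `f' x / x` is a constant minus an increasing function.
  by_contra! hneg
  have hy0 : 0 < y := lt_of_le_of_ne h0 (by rintro rfl; linarith)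
  have hy1 : y < 1 := lt_of_le_of_ne h1 (by rintro rfl; linarith)
  have hcont : Continuous f := by simp only [hf]; fun_prop
  have hder : ∀ x ∈ Set.Ioo (0 : ℝ) 1,
      HasDerivAt f (4 * log 2 * x - (log (1 + x) - log (1 - x))) x := by
    intro x hx
    have a := ((hasDerivAt_id x).const_add 1)
    have b := ((hasDerivAt_id x).const_sub 1)
    have a' := (hasDerivAt_negMulLog (x := 1 + x) (by linarith [hx.1])).comp x a
    have b' := (hasDerivAt_negMulLog (x := 1 - x) (by linarith [hx.2])).comp x b
    have c := (((hasDerivAt_id x).pow 2).const_mul (2 * log 2))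
    refine ((c.add a').add b').congr_deriv ?_
    simp
    ring
  obtain ⟨c, hc, hc'⟩ := exists_hasDerivAt_eq_slope f _ hy0 hcont.continuousOn
    (fun x hx => hder x ⟨hx.1, hx.2.trans hy1⟩)
  obtain ⟨d, hd, hd'⟩ := exists_hasDerivAt_eq_slope f _ hy1 hcont.continuousOn
    (fun x hx => hder x ⟨hy0.trans hx.1, hx.2⟩)
  rw [hf0] at hc'
  rw [hf1] at hd'
  have h3 : (f y - 0) / (y - 0) < 0 := div_neg_of_neg_of_pos (by linarith) (by linarith)
  have h4 : 0 < (0 - f y) / (1 - y) := div_pos (by linarith) (by linarith)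
  have hd0 := hy0.trans hd.1
  have h5 := log_add_sub_log_sub_le hc.1 (hc.2.trans hd.1).le hd.2
  have h6 : 0 < c / d * (4 * log 2 * d - (log (1 + d) - log (1 - d))) :=
    mul_pos (div_pos hc.1 hd0) (hd' ▸ h4)
  have h7 : c / d * (4 * log 2 * d) = 4 * log 2 * c := by field_simp
  rw [mul_sub, h7] at h6
  linarith

/-- The parabola bound `4 p (1 - p) log 2 ≤ h(p)` for the binary entropy in nats,
at `p = (1 + y) / 2`. -/
lemma parabola_le_binEntropy {y : ℝ} (hy : |y| ≤ 1) :
    2 * log 2 * (1 - y ^ 2) ≤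
      2 * log 2 + negMulLog (1 + y) + negMulLog (1 - y) := by
  rcases abs_cases y with ⟨h, _⟩ | ⟨h, _⟩
  · exact parabola_le_binEntropy_of_nonneg (h ▸ abs_nonneg y) (h ▸ hy)
  · have := parabola_le_binEntropy_of_nonneg (h ▸ abs_nonneg y) (h ▸ hy)
    simp only [neg_sq, sub_neg_eq_add, ← sub_eq_add_neg] at this
    linarith

/-- The parabola bound at `y = (q 0 - q 1) / s`, made homogeneous of degree two so that it covers
zero mass. -/
lemma mul_massEntropy_two_ge {q : Fin 2 → ℝ} (hq : ∀ a, 0 ≤ q a) :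
    4 * log 2 * (q 0 * q 1) ≤ (q 0 + q 1) * massEntropy q := by
  rcases (add_nonneg (hq 0) (hq 1)).eq_or_lt with h | h
  · have h0 : q 0 = 0 := by linarith [hq 0, hq 1]
    have h1 : q 1 = 0 := by linarith
    simp [h0, h1]
  set s := q 0 + q 1 with hs
  have hb := parabola_le_binEntropy (y := (q 0 - q 1) / s) (by
    rw [abs_div, abs_of_pos h, div_le_one h, abs_le]
    constructor <;> linarith [hq 0, hq 1])
  have e0 : 1 + (q 0 - q 1) / s = 2 / s * q 0 := by field_simp; rw [hs]; ring
  have e1 : 1 - (q 0 - q 1) / s = 2 / s * q 1 := by field_simp; rw [hs]; ring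
  have hm : massEntropy q = s / 2 * massEntropy (fun a => 2 / s * q a) := by
    rw [massEntropy_const_mul]; field_simp
  have e2 : (2 / s * q 0) + (2 / s * q 1) = 2 := by rw [← mul_add, ← hs]; field_simp
  rw [e0, e1] at hb
  have hm' : massEntropy (fun a => 2 / s * q a) =
      2 * log 2 + negMulLog (2 / s * q 0) + negMulLog (2 / s * q 1) := by
    simp only [massEntropy, Fin.sum_univ_two, e2]
    simp only [negMulLog]; ring
  have e3 : 4 * log 2 * (q 0 * q 1) =
      s * (s / 2 * (2 * log 2 * (1 - ((q 0 - q 1) / s) ^ 2))) := by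
    field_simp; rw [hs]; ring
  rw [e3, hm, hm']
  gcongr

open Matrix

/-! ### Entropic uncertainty relations and tensor products -/

section
variable {α β : Type*} [Fintype α] [Fintype β]

/-- The squared norm of a vector. -/
def normSqSum (ψ : α → ℂ) : ℝ := ∑ k, Complex.normSq (ψ k)

/-- The outcome weights of the vector `ψ` measured in the basis formed by the columns of `U`. -/
def basisDist (U : Matrix α α ℂ) (ψ : α → ℂ) (k : α) : ℝ := Complex.normSq ((Uᴴ *ᵥ ψ) k)

/-- The entropic uncertainty relation with constant `c` for the bases formed by the columns of
`U` and `W`. -/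
def EntropicUncertainty (U W : Matrix α α ℂ) (c : ℝ) : Prop :=
  ∀ ψ : α → ℂ, c * normSqSum ψ ≤ massEntropy (basisDist U ψ) + massEntropy (basisDist W ψ)

lemma basisDist_nonneg (U : Matrix α α ℂ) (ψ : α → ℂ) (k : α) : 0 ≤ basisDist U ψ k :=
  Complex.normSq_nonneg _

lemma normSqSum_nonneg (ψ : α → ℂ) : 0 ≤ normSqSum ψ :=
  Finset.sum_nonneg fun _ _ => Complex.normSq_nonneg _

lemma ofReal_normSqSum (ψ : α → ℂ) : (normSqSum ψ : ℂ) = star ψ ⬝ᵥ ψ := by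
  simp [normSqSum, dotProduct, Complex.normSq_eq_conj_mul_self]

lemma sum_basisDist [DecidableEq α] {U : Matrix α α ℂ} (hU : U * Uᴴ = 1) (ψ : α → ℂ) :
    ∑ k, basisDist U ψ k = normSqSum ψ := by
  have : normSqSum (Uᴴ *ᵥ ψ) = normSqSum ψ := by
    apply Complex.ofReal_injective
    rw [ofReal_normSqSum, ofReal_normSqSum, star_mulVec, dotProduct_mulVec, vecMul_vecMul,
      conjTranspose_conjTranspose, hU, vecMul_one]
  exact this

lemma normSqSum_smul (c : ℂ) (ψ : α → ℂ) :
    normSqSum (c • ψ) = Complex.normSq c * normSqSum ψ := by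
  simp [normSqSum, Finset.mul_sum]

lemma basisDist_smul (U : Matrix α α ℂ) (c : ℂ) (ψ : α → ℂ) :
    basisDist U (c • ψ) = fun k => Complex.normSq c * basisDist U ψ k := by
  ext k
  simp [basisDist, mulVec_smul]

lemma basisDist_submatrix (e : β ≃ α) (U : Matrix α α ℂ) (ψ : β → ℂ) (k : β) :
    basisDist (U.submatrix e e) ψ k = basisDist U (ψ ∘ e.symm) (e k) := by
  simp only [basisDist, conjTranspose_submatrix, submatrix_mulVec_equiv, Function.comp]

lemma normSqSum_comp_equiv (e : β ≃ α) (ψ : α → ℂ) : normSqSum (ψ ∘ e) = normSqSum ψ :=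
  e.sum_comp fun k => Complex.normSq (ψ k)

lemma EntropicUncertainty.submatrix {U W : Matrix α α ℂ} {c : ℝ} (h : EntropicUncertainty U W c)
    (e : β ≃ α) : EntropicUncertainty (U.submatrix e e) (W.submatrix e e) c := by
  intro ψ
  have key (U : Matrix α α ℂ) : massEntropy (basisDist (U.submatrix e e) ψ) =
      massEntropy (basisDist U (ψ ∘ e.symm)) := by
    rw [← massEntropy_comp_equiv e]
    congr 1
    ext k
    exact basisDist_submatrix e U ψ k
  rw [key, key, ← normSqSum_comp_equiv e.symm]
  exact h _

open scoped Kronecker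

lemma kronecker_mulVec_apply (A : Matrix α α ℂ) (B : Matrix β β ℂ) (ψ : α × β → ℂ) (k : α) (l : β) :
    ((A ⊗ₖ B) *ᵥ ψ) (k, l) = (B *ᵥ fun b => (A *ᵥ fun a => ψ (a, b)) k) l := by
  simp only [mulVec, dotProduct, kroneckerMap_apply, Fintype.sum_prod_type, Finset.mul_sum]
  rw [Finset.sum_comm]
  refine Finset.sum_congr rfl fun b _ => Finset.sum_congr rfl fun a _ => ?_
  ring

lemma kronecker_mulVec_apply' (A : Matrix α α ℂ) (B : Matrix β β ℂ) (ψ : α × β → ℂ)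
    (k : α) (l : β) :
    ((A ⊗ₖ B) *ᵥ ψ) (k, l) = (A *ᵥ fun a => (B *ᵥ fun b => ψ (a, b)) l) k := by
  simp only [mulVec, dotProduct, kroneckerMap_apply, Fintype.sum_prod_type, Finset.mul_sum]
  refine Finset.sum_congr rfl fun b _ => Finset.sum_congr rfl fun a _ => ?_
  ring

lemma basisDist_kronecker (U : Matrix α α ℂ) (V : Matrix β β ℂ) (ψ : α × β → ℂ)
    (k : α) (l : β) :
    basisDist (U ⊗ₖ V) ψ (k, l) = basisDist V (fun b => (Uᴴ *ᵥ fun a => ψ (a, b)) k) l := by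
  simp only [basisDist, conjTranspose_kronecker, kronecker_mulVec_apply]

lemma basisDist_kronecker' (U : Matrix α α ℂ) (V : Matrix β β ℂ) (ψ : α × β → ℂ)
    (k : α) (l : β) :
    basisDist (U ⊗ₖ V) ψ (k, l) = basisDist U (fun a => (Vᴴ *ᵥ fun b => ψ (a, b)) l) k := by
  simp only [basisDist, conjTranspose_kronecker, kronecker_mulVec_apply']

lemma sum_normSqSum_mulVec_left [DecidableEq α] {U : Matrix α α ℂ} (hU : U * Uᴴ = 1)
    (ψ : α × β → ℂ) :
    ∑ k, normSqSum (fun b => (Uᴴ *ᵥ fun a => ψ (a, b)) k) = normSqSum ψ := by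
  have := fun b => sum_basisDist hU fun a => ψ (a, b)
  simp only [basisDist, normSqSum] at this
  simp only [normSqSum, Fintype.sum_prod_type]
  rw [Finset.sum_comm, Finset.sum_comm (γ := α)]
  exact Finset.sum_congr rfl fun b _ => this b

lemma sum_normSqSum_mulVec_right [DecidableEq β] {V : Matrix β β ℂ} (hV : V * Vᴴ = 1)
    (ψ : α × β → ℂ) :
    ∑ l, normSqSum (fun a => (Vᴴ *ᵥ fun b => ψ (a, b)) l) = normSqSum ψ := by
  have := fun a => sum_basisDist hV fun b => ψ (a, b)
  simp only [basisDist, normSqSum] at this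
  simp only [normSqSum, Fintype.sum_prod_type]
  rw [Finset.sum_comm]
  exact Finset.sum_congr rfl fun b _ => this b

/-- Entropic uncertainty relations add up under tensor products. -/
lemma EntropicUncertainty.kronecker [DecidableEq α] [DecidableEq β] {u w : Matrix α α ℂ}
    {U W : Matrix β β ℂ} {c d : ℝ} (h : EntropicUncertainty u w c) (h' : EntropicUncertainty U W d)
    (hu : u * uᴴ = 1) (hw : w * wᴴ = 1) (hU : U * Uᴴ = 1) (hW : W * Wᴴ = 1) :
    EntropicUncertainty (u ⊗ₖ U) (w ⊗ₖ W) (c + d) := by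
  intro ψ
  -- The hybrid basis `u ⊗ W` links the two: a marginal does not depend on the basis chosen for the
  -- factor summed out, so the hybrid shares one marginal with `w ⊗ W` and the other with `u ⊗ U`.
  have hX : ∀ l, ∑ k, basisDist (w ⊗ₖ W) ψ (k, l) = ∑ k, basisDist (u ⊗ₖ W) ψ (k, l) := fun l => by
    simp only [basisDist_kronecker', sum_basisDist hu, sum_basisDist hw]
  have hZ : ∀ k, ∑ l, basisDist (u ⊗ₖ U) ψ (k, l) = ∑ l, basisDist (u ⊗ₖ W) ψ (k, l) := fun k => by
    simp only [basisDist_kronecker, sum_basisDist hU, sum_basisDist hW]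
  -- Each marginal entropy of the hybrid dominates the corresponding conditional entropy.
  have s1 := sum_massEntropy_le (q := fun k l => basisDist (u ⊗ₖ W) ψ (k, l))
    fun _ _ => basisDist_nonneg _ _ _
  have s2 := sum_massEntropy_le (q := fun l k => basisDist (u ⊗ₖ W) ψ (k, l))
    fun _ _ => basisDist_nonneg _ _ _
  -- Fixing the outcome on one factor leaves an unnormalised vector on the other, to which the given
  -- relation applies.
  have t1 : d * normSqSum ψ ≤ ∑ k, massEntropy (fun l => basisDist (u ⊗ₖ U) ψ (k, l)) +
      ∑ k, massEntropy (fun l => basisDist (u ⊗ₖ W) ψ (k, l)) := by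
    rw [← sum_normSqSum_mulVec_left hu, Finset.mul_sum, ← Finset.sum_add_distrib]
    refine Finset.sum_le_sum fun k _ => ?_
    simp only [basisDist_kronecker]
    exact h' _
  have t2 : c * normSqSum ψ ≤ ∑ l, massEntropy (fun k => basisDist (u ⊗ₖ W) ψ (k, l)) +
      ∑ l, massEntropy (fun k => basisDist (w ⊗ₖ W) ψ (k, l)) := by
    rw [← sum_normSqSum_mulVec_right hW, Finset.mul_sum, ← Finset.sum_add_distrib]
    refine Finset.sum_le_sum fun k _ => ?_
    simp only [basisDist_kronecker']
    exact h _
  rw [massEntropy_prod (basisDist (u ⊗ₖ U) ψ), massEntropy_prod_right (basisDist (w ⊗ₖ W) ψ)]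
  simp only [hX, hZ]
  linarith

end

section tensorPow
open scoped Kronecker

lemma tensorPow_mul (n : ℕ) (U V : Matrix (Fin 2) (Fin 2) ℂ) :
    tensorPow n U * tensorPow n V = tensorPow n (U * V) := by
  ext x y
  simp only [tensorPow, mul_apply, of_apply, ← Finset.prod_mul_distrib]
  rw [Finset.prod_univ_sum, Fintype.piFinset_univ]

lemma tensorPow_conjTranspose (n : ℕ) (U : Matrix (Fin 2) (Fin 2) ℂ) :
    (tensorPow n U)ᴴ = tensorPow n Uᴴ := by
  ext x y
  simp [tensorPow]

lemma tensorPow_one (n : ℕ) : tensorPow n 1 = 1 := by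
  ext x y
  simp only [tensorPow, of_apply, one_apply, Finset.prod_boole, Finset.mem_univ, true_imp_iff,
    funext_iff]

lemma tensorPow_unitary (n : ℕ) {U : Matrix (Fin 2) (Fin 2) ℂ} (hU : U * Uᴴ = 1) :
    tensorPow n U * (tensorPow n U)ᴴ = 1 := by
  rw [tensorPow_conjTranspose, tensorPow_mul, hU, tensorPow_one]

lemma tensorPow_succ (n : ℕ) (U : Matrix (Fin 2) (Fin 2) ℂ) :
    tensorPow (n + 1) U = (U ⊗ₖ tensorPow n U).submatrix
      (Fin.consEquiv fun _ => Fin 2).symm (Fin.consEquiv fun _ => Fin 2).symm := by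
  ext x y
  simp [tensorPow, Fin.prod_univ_succ, Fin.tail]

lemma EntropicUncertainty.tensorPow {U W : Matrix (Fin 2) (Fin 2) ℂ} {c : ℝ}
    (h : EntropicUncertainty U W c) (hU : U * Uᴴ = 1) (hW : W * Wᴴ = 1) (n : ℕ) :
    EntropicUncertainty (tensorPow n U) (tensorPow n W) (n * c) := by
  induction n with
  | zero =>
    intro ψ
    simpa using add_nonneg (massEntropy_nonneg (basisDist_nonneg _ ψ))
      (massEntropy_nonneg (basisDist_nonneg _ ψ))
  | succ n ih =>
    rw [tensorPow_succ, tensorPow_succ]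
    have e : ((n + 1 : ℕ) : ℝ) * c = c + n * c := by push_cast; ring
    rw [e]
    exact (h.kronecker ih hU hW (tensorPow_unitary n hU) (tensorPow_unitary n hW)).submatrix _

end tensorPow

/-! ### The three qubit bases -/

/-- The one-qubit unitaries `I`, `H`, `K`. -/
noncomputable def qubitUnitary : Fin 3 → Matrix (Fin 2) (Fin 2) ℂ := ![1, hadamard, kMatrix]

lemma basisUnitary_eq (n : ℕ) (t : Fin 3) : basisUnitary n t = tensorPow n (qubitUnitary t) := by
  fin_cases t <;> rfl

lemma inv_sqrt_two_mul_self : (((√2 : ℝ) : ℂ)⁻¹) * ((√2 : ℝ) : ℂ)⁻¹ = 1 / 2 := by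
  rw [← mul_inv, ← Complex.ofReal_mul, Real.mul_self_sqrt (by norm_num)]
  norm_num

lemma normSq_inv_sqrt_two : Complex.normSq (((√2 : ℝ) : ℂ)⁻¹) = 1 / 2 := by
  rw [Complex.normSq_inv, Complex.normSq_ofReal, Real.mul_self_sqrt (by norm_num), one_div]

lemma qubitUnitary_unitary (t : Fin 3) : qubitUnitary t * (qubitUnitary t)ᴴ = 1 := by
  fin_cases t
  · simp [qubitUnitary]
  · ext i j
    fin_cases i <;> fin_cases j <;>
      simp [qubitUnitary, hadamard, mul_apply, inv_sqrt_two_mul_self] <;> norm_num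
  · ext i j
    fin_cases i <;> fin_cases j <;>
      simp [qubitUnitary, kMatrix, pauliX, mul_apply] <;> ring_nf <;>
      simp [pow_two, inv_sqrt_two_mul_self] <;> norm_num

lemma basisUnitary_unitary (n : ℕ) (t : Fin 3) :
    basisUnitary n t * (basisUnitary n t)ᴴ = 1 := by
  rw [basisUnitary_eq]
  exact tensorPow_unitary n (qubitUnitary_unitary t)

lemma basisDist_one (ψ : Fin 2 → ℂ) : basisDist (qubitUnitary 0) ψ =
    ![(ψ 0).re ^ 2 + (ψ 0).im ^ 2, (ψ 1).re ^ 2 + (ψ 1).im ^ 2] := by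
  ext k
  fin_cases k <;> simp [qubitUnitary, basisDist, Complex.normSq_apply] <;> ring

lemma basisDist_hadamard (ψ : Fin 2 → ℂ) : basisDist (qubitUnitary 1) ψ =
    ![(((ψ 0).re + (ψ 1).re) ^ 2 + ((ψ 0).im + (ψ 1).im) ^ 2) / 2,
      (((ψ 0).re - (ψ 1).re) ^ 2 + ((ψ 0).im - (ψ 1).im) ^ 2) / 2] := by
  ext k
  fin_cases k <;> simp [qubitUnitary, hadamard, basisDist, mulVec, dotProduct, ← mul_add,
    ← mul_sub, ← sub_eq_add_neg] <;> simp [Complex.normSq_apply] <;> ring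

lemma basisDist_kMatrix (ψ : Fin 2 → ℂ) : basisDist (qubitUnitary 2) ψ =
    ![(((ψ 0).re + (ψ 1).im) ^ 2 + ((ψ 0).im - (ψ 1).re) ^ 2) / 2,
      (((ψ 0).im + (ψ 1).re) ^ 2 + ((ψ 1).im - (ψ 0).re) ^ 2) / 2] := by
  ext k
  fin_cases k <;> simp [qubitUnitary, kMatrix, pauliX, basisDist, mulVec, dotProduct, mul_assoc,
    ← mul_add, ← mul_neg] <;>
    simp [Complex.normSq_apply] <;> ring

/-- The parabola bound replaces each entropy by a quadratic form in the weights, leaving a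
polynomial inequality. -/
lemma qubit_entropicUncertainty_of_le {U W : Matrix (Fin 2) (Fin 2) ℂ}
    (hU : U * Uᴴ = 1) (hW : W * Wᴴ = 1)
    (h : ∀ ψ, normSqSum ψ ^ 2 ≤ 4 * (basisDist U ψ 0 * basisDist U ψ 1) +
      4 * (basisDist W ψ 0 * basisDist W ψ 1)) : EntropicUncertainty U W (log 2) := by
  intro ψ
  have h1 := mul_massEntropy_two_ge (basisDist_nonneg U ψ)
  have h2 := mul_massEntropy_two_ge (basisDist_nonneg W ψ)
  have hl : 0 < log 2 := log_pos (by norm_num)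
  rw [← Fin.sum_univ_two, sum_basisDist hU] at h1
  rw [← Fin.sum_univ_two, sum_basisDist hW] at h2
  have h3 := mul_le_mul_of_nonneg_left (h ψ) hl.le
  rcases (normSqSum_nonneg ψ).eq_or_lt with h0 | h0
  · rw [← h0]
    simpa using add_nonneg (massEntropy_nonneg (basisDist_nonneg U ψ))
      (massEntropy_nonneg (basisDist_nonneg W ψ))
  · refine le_of_mul_le_mul_left ?_ h0
    nlinarith

lemma EntropicUncertainty.symm {α : Type*} [Fintype α] {U W : Matrix α α ℂ} {c : ℝ}
    (h : EntropicUncertainty U W c) : EntropicUncertainty W U c := fun ψ => by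
  rw [add_comm]
  exact h ψ

lemma qubit_entropicUncertainty {s t : Fin 3} (hst : s ≠ t) :
    EntropicUncertainty (qubitUnitary s) (qubitUnitary t) (log 2) := by
  wlog h : s < t generalizing s t
  · exact (this hst.symm (lt_of_le_of_ne (not_lt.mp h) hst.symm)).symm
  refine qubit_entropicUncertainty_of_le (qubitUnitary_unitary s) (qubitUnitary_unitary t)
    fun ψ => ?_
  have hN : normSqSum ψ = (ψ 0).re ^ 2 + (ψ 0).im ^ 2 + ((ψ 1).re ^ 2 + (ψ 1).im ^ 2) := by
    simp [normSqSum, Complex.normSq_apply]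
    ring
  rw [hN]
  generalize hx : (ψ 0).re = a at *
  generalize hx : (ψ 0).im = b at *
  generalize hx : (ψ 1).re = c at *
  generalize hx : (ψ 1).im = d at *
  fin_cases s <;> fin_cases t <;> simp at h <;>
    simp only [Fin.zero_eta, Fin.mk_one, Fin.reduceFinMk, basisDist_one, basisDist_hadamard,
      basisDist_kMatrix, *, cons_val_zero, cons_val_one]
  -- With Bloch vector `r`, each product `4 * q 0 * q 1` is `|r|²` minus the square of one
  -- component. The slack is the square of the third component, given here in each case up to a
  -- scalar.
  · linarith [sq_nonneg (b * c - a * d)]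
  · linarith [sq_nonneg (a * c + b * d)]
  · linarith [sq_nonneg (a ^ 2 + b ^ 2 - c ^ 2 - d ^ 2)]

lemma entropicUncertainty_basisUnitary (n : ℕ) {s t : Fin 3} (hst : s ≠ t) :
    EntropicUncertainty (basisUnitary n s) (basisUnitary n t) (n * log 2) := by
  rw [basisUnitary_eq, basisUnitary_eq]
  exact (qubit_entropicUncertainty hst).tensorPow (qubitUnitary_unitary s)
    (qubitUnitary_unitary t) n


/-! ### Mutual information as an average of entropies -/

lemma log_two_mul_shannonEntropy {α : Type*} [Fintype α] (q : α → ℝ) :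
    log 2 * shannonEntropy q = ∑ a, negMulLog (q a) := by
  have : log 2 ≠ 0 := (log_pos (by norm_num)).ne'
  simp only [shannonEntropy, negMulLog, logb, mul_neg, Finset.mul_sum, neg_mul,
    Finset.sum_neg_distrib]
  congr 1
  refine Finset.sum_congr rfl fun a _ => ?_
  field_simp

/-- The prior's entropy cancels between `H(A)` and `H(AB)`. As `τ` does not depend on `t`, the
outcome entropy splits over `t` and completes each inner sum to a `massEntropy`. -/
lemma log_two_mul_mutualInfo {T K ι : Type*} [Fintype T] [Fintype K] [Fintype ι] {p : T → ℝ}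
    (hp : ∑ t, p t = 1) {d : ℝ} (hd : 0 < d) {r : T → K → ι → ℝ} {τ : ι → ℝ}
    (hi : ∀ t k, ∑ i, r t k i = 1) (hk : ∀ t i, ∑ k, r t k i = τ i) (hτ : ∑ i, τ i = d) :
    log 2 * mutualInfo (fun a : (T × K) × ι => p a.1.1 * (1 / d) * r a.1.1 a.1.2 a.2) =
      log d - 1 / d * ∑ i, ∑ t, p t * massEntropy (fun k => r t k i) := by
  have hA : ∀ x : T × K, ∑ i, p x.1 * (1 / d) * r x.1 x.2 i = p x.1 * (1 / d) := fun x => by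
    rw [← Finset.mul_sum, hi, mul_one]
  have hB : ∀ i, ∑ x : T × K, p x.1 * (1 / d) * r x.1 x.2 i = 1 / d * τ i := fun i => by
    simp only [Fintype.sum_prod_type, ← Finset.mul_sum, hk, ← Finset.sum_mul, hp]
    ring
  have hAB : ∑ a : (T × K) × ι, negMulLog (p a.1.1 * (1 / d) * r a.1.1 a.1.2 a.2) =
      ∑ x : T × K, negMulLog (p x.1 * (1 / d)) +
        1 / d * ∑ i, ∑ t, p t * ∑ k, negMulLog (r t k i) := by
    simp only [negMulLog_mul _ (r _ _ _), Fintype.sum_prod_type, Finset.sum_add_distrib,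
      ← Finset.sum_mul, hi, one_mul]
    congr 1
    simp only [Finset.mul_sum]
    rw [Finset.sum_comm (s := (Finset.univ : Finset ι))]
    refine Finset.sum_congr rfl fun t _ => ?_
    rw [Finset.sum_comm (s := (Finset.univ : Finset ι))]
    exact Finset.sum_congr rfl fun k _ => Finset.sum_congr rfl fun i _ => by ring
  have hB' : ∑ i, negMulLog (1 / d * τ i) = log d + 1 / d * ∑ i, negMulLog (τ i) := by
    simp only [negMulLog_mul, Finset.sum_add_distrib, ← Finset.sum_mul, ← Finset.mul_sum, hτ]
    congr 1
    simp [negMulLog, hd.ne']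
  simp only [mutualInfo, mul_sub, mul_add, log_two_mul_shannonEntropy, hA, hB, hB', hAB]
  simp only [massEntropy, hk, mul_sub, Finset.sum_sub_distrib, ← Finset.sum_mul, hp]
  generalize ∑ x : T × K, negMulLog (p x.1 * (1 / d)) = A
  ring

section ensemble
variable (n : ℕ)

lemma trace_vecMulVec_mul_ensembleState (ψ : Bits n → ℂ) (t : Fin 3) (k : Bits n) :
    (trace (vecMulVec ψ (star ψ) * ensembleState n (t, k))).re =
      basisDist (basisUnitary n t) ψ k := by
  set U := basisUnitary n t
  have h1 : (single k k 1 : Matrix (Bits n) (Bits n) ℂ) =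
      vecMulVec (Pi.single k 1) (Pi.single k 1) := by
    rw [single_eq_single_vecMulVec_single]
  have h : trace (vecMulVec ψ (star ψ) * ensembleState n (t, k)) =
      (Uᴴ *ᵥ ψ) k * star ((Uᴴ *ᵥ ψ) k) := by
    have hs : star ψ ᵥ* U = star (Uᴴ *ᵥ ψ) := by rw [star_mulVec, conjTranspose_conjTranspose]
    rw [show ensembleState n (t, k) = U * single k k 1 * Uᴴ from rfl, h1, mul_vecMulVec,
      vecMulVec_mul, vecMulVec_mul, trace_vecMulVec, vecMul_vecMulVec, dotProduct_mulVec, hs,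
      dotProduct_smul, dotProduct_comm ψ, ← dotProduct_mulVec]
    simp [mul_comm]
  rw [h]
  simp [basisDist, Complex.mul_conj]

end ensemble


/-- The weights `tr(E ρ)` of the effect `E` on the states of the basis `t`. -/
noncomputable def effectDist (n : ℕ) (E : Matrix (Bits n) (Bits n) ℂ) (t : Fin 3) (k : Bits n) : ℝ :=
  (trace (E * ensembleState n (t, k))).re

/-- The average entropy, over the three bases, of measuring the vector `ψ`. -/
noncomputable def averageEntropy (n : ℕ) (p : Fin 3 → ℝ) (ψ : Bits n → ℂ) : ℝ :=
  ∑ t, p t * massEntropy (basisDist (basisUnitary n t) ψ)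

section
variable {n : ℕ}

lemma effectDist_vecMulVec (ψ : Bits n → ℂ) (t : Fin 3) (k : Bits n) :
    effectDist n (vecMulVec ψ (star ψ)) t k = basisDist (basisUnitary n t) ψ k :=
  trace_vecMulVec_mul_ensembleState n ψ t k

lemma effectDist_sum {ι : Type*} (s : Finset ι) (E : ι → Matrix (Bits n) (Bits n) ℂ) (t : Fin 3)
    (k : Bits n) : effectDist n (∑ i ∈ s, E i) t k = ∑ i ∈ s, effectDist n (E i) t k := by
  simp only [effectDist, Finset.sum_mul, trace_sum, Complex.re_sum]

lemma sum_single_eq_one : ∑ k : Bits n, single k k (1 : ℂ) = 1 := by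
  ext x y
  rw [Matrix.sum_apply, one_apply]
  by_cases h : x = y
  · simp [single_apply, h]
  · simp only [single_apply, if_neg h]
    refine Finset.sum_eq_zero fun k _ => if_neg ?_
    rintro ⟨rfl, rfl⟩
    exact h rfl

lemma sum_effectDist (E : Matrix (Bits n) (Bits n) ℂ) (t : Fin 3) :
    ∑ k, effectDist n E t k = (trace E).re := by
  simp only [effectDist, ← Complex.re_sum, ← trace_sum, ← Finset.mul_sum]
  have : ∑ k, ensembleState n (t, k) = 1 := by
    simp only [ensembleState, ← Finset.sum_mul, ← Finset.mul_sum, sum_single_eq_one, mul_one,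
      basisUnitary_unitary]
  rw [this, mul_one]

lemma effectDist_one (t : Fin 3) (k : Bits n) : effectDist n 1 t k = 1 := by
  have h := mul_eq_one_comm.mp (basisUnitary_unitary n t)
  rw [effectDist, one_mul, ensembleState, trace_mul_comm, ← mul_assoc, h, one_mul, trace_single_eq_same]
  simp

lemma card_bits : (Fintype.card (Bits n) : ℝ) = 2 ^ n := by simp

lemma IsPOVM.sum_trace_re {ι : Type*} [Fintype ι] {E : ι → Matrix (Bits n) (Bits n) ℂ}
    (hE : IsPOVM E) : ∑ i, (trace (E i)).re = 2 ^ n := by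
  rw [← Complex.re_sum, ← trace_sum, hE.sum_eq_one, trace_one, Complex.natCast_re, card_bits]

lemma log_two_mul_mutualInfo_of_isPOVM {ι : Type*} [Fintype ι] {p : Fin 3 → ℝ}
    (hp : ∑ t, p t = 1) {E : ι → Matrix (Bits n) (Bits n) ℂ} (hE : IsPOVM E) :
    log 2 * mutualInfo (jointDist (ensemblePrior n p) (ensembleState n) E) =
      n * log 2 - 1 / 2 ^ n * ∑ i, ∑ t, p t * massEntropy (effectDist n (E i) t) := by
  have h := log_two_mul_mutualInfo hp (d := 2 ^ n) (by positivity)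
    (r := fun t k i => effectDist n (E i) t k) (τ := fun i => (trace (E i)).re)
    (fun t k => by rw [← effectDist_sum, hE.sum_eq_one, effectDist_one])
    (fun t i => sum_effectDist (E i) t)
    hE.sum_trace_re
  rw [log_pow] at h
  exact h

lemma IsPOVM.comp_equiv {ι κ H : Type*} [Fintype ι] [Fintype κ] [DecidableEq H]
    {E : ι → Matrix H H ℂ} (hE : IsPOVM E) (e : κ ≃ ι) : IsPOVM (E ∘ e) :=
  ⟨fun k => hE.posSemidef (e k), by rw [← hE.sum_eq_one, ← e.sum_comp E]; rfl⟩

/-- A POVM may be labelled by any finite type. -/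
lemma mutualInfo_mem_attainableInfo {ι : Type*} [Fintype ι] {p : Fin 3 → ℝ}
    (hp : ∑ t, p t = 1) {E : ι → Matrix (Bits n) (Bits n) ℂ} (hE : IsPOVM E) :
    mutualInfo (jointDist (ensemblePrior n p) (ensembleState n) E) ∈
      attainableInfo (ensemblePrior n p) (ensembleState n) := by
  set e := (Fintype.equivFin ι).symm
  refine ⟨_, E ∘ e, hE.comp_equiv e, ?_⟩
  apply mul_left_cancel₀ (log_pos one_lt_two).ne'
  rw [log_two_mul_mutualInfo_of_isPOVM hp hE, log_two_mul_mutualInfo_of_isPOVM hp (hE.comp_equiv e),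
    ← e.sum_comp]
  rfl

open scoped MatrixOrder in
-- Factor `E = B* B` and take the conjugated rows of `B`.
lemma exists_eq_sum_vecMulVec {E : Matrix (Bits n) (Bits n) ℂ} (hE : E.PosSemidef) :
    ∃ v : Bits n → Bits n → ℂ, E = ∑ j, vecMulVec (v j) (star (v j)) := by
  obtain ⟨B, rfl⟩ := CStarAlgebra.nonneg_iff_eq_star_mul_self.mp hE.nonneg
  refine ⟨fun j => star (B j), ?_⟩
  ext x y
  simp [mul_apply, Matrix.sum_apply, vecMulVec_apply, star_apply]

lemma trace_vecMulVec_star (ψ : Bits n → ℂ) :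
    (trace (vecMulVec ψ (star ψ))).re = normSqSum ψ := by
  rw [trace_vecMulVec, dotProduct_comm, ← ofReal_normSqSum, Complex.ofReal_re]

lemma averageEntropy_smul (p : Fin 3 → ℝ) (c : ℂ) (ψ : Bits n → ℂ) :
    averageEntropy n p (c • ψ) = Complex.normSq c * averageEntropy n p ψ := by
  simp only [averageEntropy, basisDist_smul, massEntropy_const_mul, Finset.mul_sum]
  exact Finset.sum_congr rfl fun t _ => by ring

lemma continuous_averageEntropy (p : Fin 3 → ℝ) : Continuous (averageEntropy n p) := by
  unfold averageEntropy
  refine continuous_finsetSum _ fun t _ => continuous_const.mul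
    (continuous_massEntropy.comp (continuous_pi fun k => ?_))
  exact Complex.continuous_normSq.comp
    ((continuous_apply k).comp (continuous_const.matrix_mulVec continuous_id))

lemma isCompact_normSqSum_eq_one : IsCompact {ψ : Bits n → ℂ | normSqSum ψ = 1} := by
  refine Metric.isCompact_of_isClosed_isBounded ?_ ?_
  · refine isClosed_eq ?_ continuous_const
    exact continuous_finsetSum _ fun k _ => Complex.continuous_normSq.comp (continuous_apply k)
  · refine Metric.isBounded_closedBall (x := 0) (r := 1) |>.subset fun ψ hψ => ?_
    rw [mem_closedBall_zero_iff, pi_norm_le_iff_of_nonneg zero_le_one]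
    intro k
    have h : Complex.normSq (ψ k) ≤ normSqSum ψ :=
      Finset.single_le_sum (f := fun k => Complex.normSq (ψ k))
        (fun _ _ => Complex.normSq_nonneg _) (Finset.mem_univ k)
    rw [show normSqSum ψ = 1 from hψ, Complex.normSq_eq_norm_sq] at h
    exact (sq_le_one_iff₀ (norm_nonneg _)).mp h

lemma normSqSum_single [DecidableEq (Bits n)] (k : Bits n) :
    normSqSum (Pi.single k 1 : Bits n → ℂ) = 1 := by
  simp [normSqSum, Pi.single_apply, apply_ite Complex.normSq]

lemma normSqSum_eq_zero {ψ : Bits n → ℂ} (h : normSqSum ψ = 0) : ψ = 0 := by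
  rw [normSqSum, Finset.sum_eq_zero_iff_of_nonneg fun _ _ => Complex.normSq_nonneg _] at h
  ext k
  simpa using h k (Finset.mem_univ k)

/-- The unit vectors have one of least average entropy. -/
lemma exists_minimal_averageEntropy (p : Fin 3 → ℝ) :
    ∃ φ : Bits n → ℂ, normSqSum φ = 1 ∧
      ∀ ψ, averageEntropy n p φ * normSqSum ψ ≤ averageEntropy n p ψ := by
  obtain ⟨φ, hφ, hmin⟩ := (isCompact_normSqSum_eq_one (n := n)).exists_isMinOn
    ⟨_, normSqSum_single 0⟩ (continuous_averageEntropy p).continuousOn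
  refine ⟨φ, hφ, fun ψ => ?_⟩
  rcases (normSqSum_nonneg ψ).eq_or_lt with h | h
  · obtain rfl := normSqSum_eq_zero h.symm
    have h0 : averageEntropy n p (0 : Bits n → ℂ) = 0 := by
      rw [← zero_smul ℂ (0 : Bits n → ℂ), averageEntropy_smul, map_zero, zero_mul]
    rw [← h, h0, mul_zero]
  -- Both sides scale by the squared modulus, so normalising `ψ` reduces to the unit sphere.
  · have hc : Complex.normSq ((√(normSqSum ψ) : ℝ) : ℂ)⁻¹ = (normSqSum ψ)⁻¹ := by
      rw [Complex.normSq_inv, Complex.normSq_ofReal, Real.mul_self_sqrt h.le]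
    have hm := isMinOn_iff.mp hmin ((((√(normSqSum ψ) : ℝ) : ℂ)⁻¹) • ψ) (by
      rw [Set.mem_ofPred_eq, normSqSum_smul, hc, inv_mul_cancel₀ h.ne'])
    rw [averageEntropy_smul, hc, inv_mul_eq_div, le_div_iff₀ h] at hm
    exact hm

/-- A lower bound for the average entropy of vectors bounds the information of every POVM. -/
lemma log_two_mul_mutualInfo_le {ι : Type*} [Fintype ι] {p : Fin 3 → ℝ} (hp0 : ∀ t, 0 ≤ p t)
    (hp : ∑ t, p t = 1) {c : ℝ} (hc : ∀ ψ : Bits n → ℂ, c * normSqSum ψ ≤ averageEntropy n p ψ)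
    {E : ι → Matrix (Bits n) (Bits n) ℂ} (hE : IsPOVM E) :
    log 2 * mutualInfo (jointDist (ensemblePrior n p) (ensembleState n) E) ≤ n * log 2 - c := by
  have key : ∀ i, c * (trace (E i)).re ≤ ∑ t, p t * massEntropy (effectDist n (E i) t) := by
    intro i
    obtain ⟨v, hv⟩ := exists_eq_sum_vecMulVec (hE.posSemidef i)
    have hd : ∀ t, effectDist n (E i) t = fun k => ∑ j, basisDist (basisUnitary n t) (v j) k := by
      intro t
      ext k
      rw [hv, effectDist_sum]
      simp only [effectDist_vecMulVec]
    calc c * (trace (E i)).re = ∑ j, c * normSqSum (v j) := by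
          rw [hv, trace_sum, Complex.re_sum, Finset.mul_sum]
          simp only [trace_vecMulVec_star]
      _ ≤ ∑ j, averageEntropy n p (v j) := Finset.sum_le_sum fun j _ => hc (v j)
      _ = ∑ t, p t * ∑ j, massEntropy (basisDist (basisUnitary n t) (v j)) := by
          simp only [averageEntropy, Finset.mul_sum]
          rw [Finset.sum_comm]
      _ ≤ ∑ t, p t * massEntropy (effectDist n (E i) t) := by
          refine Finset.sum_le_sum fun t _ => mul_le_mul_of_nonneg_left ?_ (hp0 t)
          rw [hd]
          exact sum_massEntropy_le fun _ _ => basisDist_nonneg _ _ _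
  have hsum := Finset.sum_le_sum fun i (_ : i ∈ Finset.univ) => key i
  rw [← Finset.mul_sum, hE.sum_trace_re] at hsum
  rw [log_two_mul_mutualInfo_of_isPOVM hp hE]
  have : c ≤ 1 / 2 ^ n * ∑ i, ∑ t, p t * massEntropy (effectDist n (E i) t) := by
    rw [one_div, inv_mul_eq_div, le_div_iff₀ (by positivity)]
    exact hsum
  linarith

lemma log_two_mul_mutualInfo_vecMulVec {ι : Type*} [Fintype ι] {p : Fin 3 → ℝ}
    (hp : ∑ t, p t = 1) {v : ι → Bits n → ℂ}
    (hv : IsPOVM fun i => vecMulVec (v i) (star (v i))) :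
    log 2 * mutualInfo (jointDist (ensemblePrior n p) (ensembleState n)
        fun i => vecMulVec (v i) (star (v i))) =
      n * log 2 - 1 / 2 ^ n * ∑ i, averageEntropy n p (v i) := by
  rw [log_two_mul_mutualInfo_of_isPOVM hp hv]
  simp only [averageEntropy, funext (effectDist_vecMulVec _ _)]

end


/-! ### Pauli orbits and existence of the maximum -/

/-- The sign `(-1) ^ (b x)`. -/
def bitSign (b x : Fin 2) : ℂ := (-1) ^ (b.val * x.val)

/-- The vector obtained from `φ` by the Pauli operator with shift `a` and phase `b`. -/
def pauliTwist {n : ℕ} (φ : Bits n → ℂ) (a b : Bits n) : Bits n → ℂ :=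
  fun x => (∏ l, bitSign (b l) (x l)) * φ (x + a)

lemma star_bitSign (b x : Fin 2) : star (bitSign b x) = bitSign b x := by
  simp [bitSign]

lemma sum_bitSign_mul (x y : Fin 2) :
    ∑ b, bitSign b x * bitSign b y = if x = y then 2 else 0 := by
  fin_cases x <;> fin_cases y <;> norm_num [bitSign]

lemma bits_add_self {n : ℕ} (x a : Bits n) : x + a + a = x := by
  ext l
  have : ∀ i j : Fin 2, i + j + j = i := by decide
  simp [this]

/-- The Pauli operators permute each of the three qubit bases, up to phases. -/
lemma exists_qubit_pauli_shift (t : Fin 3) (a b : Fin 2) :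
    ∃ s : Fin 2, ∀ k, ∃ θ : ℂ, Complex.normSq θ = 1 ∧ ∀ y,
      star (qubitUnitary t (y + a) k) * bitSign b (y + a) =
        θ * star (qubitUnitary t y (k + s)) := by
  -- The bit flip swaps the vectors of bases 0 and 2, the phase flip those of bases 1 and 2; the
  -- phases that occur are `±1` and `±I`.
  refine ⟨![a, b, a + b] t, fun k => ?_⟩
  simp only [Fin.forall_fin_two]
  fin_cases t <;> fin_cases a <;> fin_cases b <;> fin_cases k <;>
    first
    | (refine ⟨1, ?_, ?_, ?_⟩ <;>
        simp [qubitUnitary, hadamard, kMatrix, pauliX, bitSign]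
       done)
    | (refine ⟨-1, ?_, ?_, ?_⟩ <;>
        simp [qubitUnitary, hadamard, kMatrix, pauliX, bitSign]
       done)
    | (refine ⟨Complex.I, ?_, ?_, ?_⟩ <;>
        simp [qubitUnitary, hadamard, kMatrix, pauliX, bitSign, mul_comm Complex.I, mul_assoc]
       done)
    | (refine ⟨-Complex.I, ?_, ?_, ?_⟩ <;>
        simp [qubitUnitary, hadamard, kMatrix, pauliX, bitSign, mul_comm Complex.I, mul_assoc])

lemma exists_basisDist_pauliTwist {n : ℕ} (t : Fin 3) (a b : Bits n) :
    ∃ s : Bits n, ∀ φ k, basisDist (basisUnitary n t) (pauliTwist φ a b) k =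
      basisDist (basisUnitary n t) φ (k + s) := by
  choose s θ hθ h using exists_qubit_pauli_shift t
  refine ⟨fun l => s (a l) (b l), fun φ k => ?_⟩
  have key : ((basisUnitary n t)ᴴ *ᵥ pauliTwist φ a b) k =
      (∏ l, θ (a l) (b l) (k l)) *
        ((basisUnitary n t)ᴴ *ᵥ φ) (k + fun l => s (a l) (b l)) := by
    simp only [mulVec, dotProduct, Finset.mul_sum]
    rw [← Equiv.sum_comp (Equiv.addRight a)]
    refine Finset.sum_congr rfl fun y _ => ?_
    simp only [Equiv.coe_addRight, pauliTwist, bits_add_self, conjTranspose_apply,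
      basisUnitary_eq, tensorPow, of_apply, star_prod, ← mul_assoc, ← Finset.prod_mul_distrib]
    congr 1
    exact Finset.prod_congr rfl fun l _ => h (a l) (b l) (k l) (y l)
  simp only [basisDist, key, map_mul, map_prod, hθ, Finset.prod_const_one, one_mul]

lemma averageEntropy_pauliTwist {n : ℕ} (p : Fin 3 → ℝ) (φ : Bits n → ℂ) (a b : Bits n) :
    averageEntropy n p (pauliTwist φ a b) = averageEntropy n p φ := by
  refine Finset.sum_congr rfl fun t _ => ?_
  obtain ⟨s, hs⟩ := exists_basisDist_pauliTwist t a b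
  rw [← massEntropy_comp_equiv (Equiv.addRight s) (basisDist (basisUnitary n t) φ)]
  congr 2
  ext k
  exact hs φ k

/-- The Pauli orbit of a vector is a tight frame. -/
lemma sum_pauliTwist {n : ℕ} (φ : Bits n → ℂ) :
    ∑ ab : Bits n × Bits n, vecMulVec (pauliTwist φ ab.1 ab.2) (star (pauliTwist φ ab.1 ab.2)) =
      ((2 ^ n * normSqSum φ : ℝ) : ℂ) • 1 := by
  ext x y
  -- Orthogonality of characters kills the off-diagonal entries; summing over shifts makes the
  -- diagonal constant.
  have hsign : ∑ b : Bits n, (∏ l, bitSign (b l) (x l)) * ∏ l, bitSign (b l) (y l) =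
      if x = y then 2 ^ n else 0 := by
    simp only [← Finset.prod_mul_distrib]
    rw [← Fintype.piFinset_univ, ← Finset.prod_univ_sum (fun _ => Finset.univ)
      (fun l b => bitSign b (x l) * bitSign b (y l))]
    simp only [sum_bitSign_mul]
    rw [Finset.prod_ite_zero]
    simp [funext_iff]
  have hφ : ∑ a, φ (x + a) * star (φ (x + a)) = (normSqSum φ : ℂ) := by
    rw [ofReal_normSqSum, dotProduct_comm]
    exact Equiv.sum_comp (Equiv.addLeft x) fun z => φ z * star (φ z)
  have hsum : ∑ ab : Bits n × Bits n,
      vecMulVec (pauliTwist φ ab.1 ab.2) (star (pauliTwist φ ab.1 ab.2)) x y =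
      (∑ a, φ (x + a) * star (φ (y + a))) *
        ∑ b : Bits n, (∏ l, bitSign (b l) (x l)) * ∏ l, bitSign (b l) (y l) := by
    rw [Fintype.sum_prod_type, Finset.sum_mul]
    refine Finset.sum_congr rfl fun a _ => ?_
    rw [Finset.mul_sum]
    refine Finset.sum_congr rfl fun b _ => ?_
    simp only [vecMulVec_apply, pauliTwist, Pi.star_apply, star_mul', star_prod, star_bitSign]
    ring
  rw [Matrix.sum_apply, hsum, hsign]
  by_cases hxy : x = y
  · subst hxy
    rw [hφ]
    simp [mul_comm]
  · simp [hxy]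

/-- The least average entropy of unit vectors determines the maximal information. -/
lemma exists_isGreatest_attainableInfo {n : ℕ} {p : Fin 3 → ℝ} (hp0 : ∀ t, 0 ≤ p t)
    (hp : ∑ t, p t = 1) :
    ∃ φ : Bits n → ℂ, normSqSum φ = 1 ∧
      (∀ ψ, averageEntropy n p φ * normSqSum ψ ≤ averageEntropy n p ψ) ∧
      IsGreatest (attainableInfo (ensemblePrior n p) (ensembleState n))
        (n - averageEntropy n p φ / log 2) := by
  obtain ⟨φ, hφ, hmin⟩ := exists_minimal_averageEntropy (n := n) p
  have hl : 0 < log 2 := log_pos one_lt_two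
  refine ⟨φ, hφ, hmin, ?_, ?_⟩
  -- The orbit of a unit vector sums to `2 ^ n` times the identity, hence the factor `1 / √(2 ^ n)`.
  · set c : ℂ := ((√(2 ^ n) : ℝ) : ℂ)⁻¹
    have hc : Complex.normSq c = 1 / 2 ^ n := by
      rw [Complex.normSq_inv, Complex.normSq_ofReal, Real.mul_self_sqrt (by positivity), one_div]
    have hcc : star c * c = 1 / 2 ^ n := by
      rw [Complex.star_def, mul_comm, Complex.mul_conj, hc]
      simp
    have hE : IsPOVM fun ab : Bits n × Bits n =>
        vecMulVec (c • pauliTwist φ ab.1 ab.2) (star (c • pauliTwist φ ab.1 ab.2)) := by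
      refine ⟨fun _ => posSemidef_vecMulVec_self_star _, ?_⟩
      simp only [star_smul, smul_vecMulVec, vecMulVec_smul, smul_smul, hcc, ← Finset.smul_sum,
        sum_pauliTwist, hφ]
      simp
    convert mutualInfo_mem_attainableInfo hp hE using 1
    apply mul_left_cancel₀ hl.ne'
    rw [log_two_mul_mutualInfo_vecMulVec hp hE]
    simp only [averageEntropy_smul, hc, averageEntropy_pauliTwist]
    simp
    field_simp
  · rintro _ ⟨m, E, hE, rfl⟩
    have h := log_two_mul_mutualInfo_le hp0 hp hmin hE
    rw [← sub_nonneg] at h ⊢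
    have : n - averageEntropy n p φ / log 2 -
        mutualInfo (jointDist (ensemblePrior n p) (ensembleState n) E) =
        (n * log 2 - averageEntropy n p φ -
          log 2 * mutualInfo (jointDist (ensemblePrior n p) (ensembleState n) E)) / log 2 := by
      field_simp
    rw [this]
    positivity

/-! ### Bounds on the least average entropy -/

/-- Maassen-Uffink for the three bases, averaged over priors of at most one half. -/
lemma half_le_averageEntropy {n : ℕ} {p : Fin 3 → ℝ} (hp : ∑ t, p t = 1)
    (hhalf : ∀ t, p t ≤ 1 / 2) (ψ : Bits n → ℂ) :
    n / 2 * log 2 * normSqSum ψ ≤ averageEntropy n p ψ := by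
  have h01 := entropicUncertainty_basisUnitary n (s := 0) (t := 1) (by decide) ψ
  have h02 := entropicUncertainty_basisUnitary n (s := 0) (t := 2) (by decide) ψ
  have h12 := entropicUncertainty_basisUnitary n (s := 1) (t := 2) (by decide) ψ
  rw [Fin.sum_univ_three] at hp
  simp only [averageEntropy, Fin.sum_univ_three]
  -- Weight each pair by `1/2 - p u`, with `u` the omitted basis: the entropy of basis `t` receives
  -- `1 - (1 - p t) = p t`, and the weights total `1/2`.
  have k01 := mul_le_mul_of_nonneg_left h01 (a := 1 / 2 - p 2) (by linarith [hhalf 2])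
  have k02 := mul_le_mul_of_nonneg_left h02 (a := 1 / 2 - p 1) (by linarith [hhalf 1])
  have k12 := mul_le_mul_of_nonneg_left h12 (a := 1 / 2 - p 0) (by linarith [hhalf 0])
  have e0 : p 0 = 1 - p 1 - p 2 := by linarith
  rw [e0] at k12 ⊢
  linarith

/-- A vector of the basis `t` has small average entropy. -/
lemma exists_averageEntropy_le {n : ℕ} {p : Fin 3 → ℝ} (hp0 : ∀ t, 0 ≤ p t) (hp : ∑ t, p t = 1)
    (t : Fin 3) : ∃ ψ : Bits n → ℂ, normSqSum ψ = 1 ∧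
      averageEntropy n p ψ ≤ (1 - p t) * (n * log 2) := by
  set U := basisUnitary n t with hU
  have hU1 : Uᴴ * U = 1 := mul_eq_one_comm.mp (basisUnitary_unitary n t)
  have hd : basisDist U (U *ᵥ Pi.single 0 1) = Pi.single 0 1 := by
    ext k
    rw [basisDist, mulVec_mulVec, hU1, one_mulVec]
    simp [Pi.single_apply, apply_ite Complex.normSq]
  have hs1 : ∑ k : Bits n, (Pi.single 0 1 : Bits n → ℝ) k = 1 := by simp
  have hn : normSqSum (U *ᵥ Pi.single 0 1) = 1 := by
    rw [← sum_basisDist (basisUnitary_unitary n t), ← hU, hd, hs1]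
  refine ⟨_, hn, ?_⟩
  have ht : massEntropy (basisDist U (U *ᵥ Pi.single 0 1)) = 0 := by
    rw [hd, massEntropy_of_flat (c := 1) (fun a => ?_) hs1]
    · simp
    · simp only [Pi.single_apply]
      split_ifs <;> simp
  have hb : ∀ s, massEntropy (basisDist (basisUnitary n s) (U *ᵥ Pi.single 0 1)) ≤ n * log 2 := by
    intro s
    have := massEntropy_le_log_card (basisDist_nonneg (basisUnitary n s) (U *ᵥ Pi.single 0 1))
      (by rw [sum_basisDist (basisUnitary_unitary n s), hn])
    rwa [card_bits, log_pow] at this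
  rw [← hp, averageEntropy, ← Finset.add_sum_erase _ _ (Finset.mem_univ t),
    ← Finset.add_sum_erase _ p (Finset.mem_univ t), ← hU, ht, mul_zero, zero_add,
    add_sub_cancel_left, Finset.sum_mul]
  exact Finset.sum_le_sum fun s _ => mul_le_mul_of_nonneg_left (hb s) (hp0 s)


/-! ### The Bell measurement -/

section bell
variable {n : ℕ}

/-- For even `n`, the qubits come in `n / 2` consecutive pairs. -/
def qubitPairEquiv (hn : Even n) : Fin (n / 2) × Fin 2 ≃ Fin n where
  toFun a := ⟨2 * a.1 + a.2, by omega⟩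
  invFun l := (⟨l / 2, by obtain ⟨m, rfl⟩ := hn; omega⟩, ⟨l % 2, by omega⟩)
  left_inv a := by ext <;> simp <;> omega
  right_inv l := by ext; simp; omega

lemma prod_eq_prod_pairs (hn : Even n) {M : Type*} [CommMonoid M] (f : Fin n → M) :
    ∏ l, f l = ∏ j : Fin (n / 2), f ⟨2 * j, by omega⟩ * f ⟨2 * j + 1, by omega⟩ := by
  rw [← (qubitPairEquiv hn).prod_comp, Fintype.prod_prod_type]
  simp only [Fin.prod_univ_two]
  rfl

/-- Distributivity over the pairs of qubits; it reduces every Bell computation to a single pair. -/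
lemma sum_prod_pairs (hn : Even n) {R : Type*} [CommSemiring R]
    (g : Fin (n / 2) → Fin 2 → Fin 2 → R) :
    ∑ x : Bits n, ∏ j : Fin (n / 2), g j (x ⟨2 * j, by omega⟩) (x ⟨2 * j + 1, by omega⟩) =
      ∏ j, ∑ a, ∑ b, g j a b := by
  let e : Bits n ≃ (Fin (n / 2) → Fin 2 × Fin 2) :=
    ((Equiv.arrowCongr (qubitPairEquiv hn).symm (Equiv.refl (Fin 2))).trans
      (Equiv.curry _ _ _)).trans (Equiv.arrowCongr (Equiv.refl _) (finTwoArrowEquiv (Fin 2)))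
  have h := Finset.prod_univ_sum (fun _ : Fin (n / 2) => (Finset.univ : Finset (Fin 2 × Fin 2)))
    (fun j ab => g j ab.1 ab.2)
  simp only [Fintype.piFinset_univ, Fintype.sum_prod_type] at h
  rw [h, ← e.sum_comp]
  rfl

lemma sum_bell_mul_star (x x' y y' : Fin 2) :
    ∑ a, ∑ b, bell a b x x' * star (bell a b y y') = if x = y ∧ x' = y' then 1 else 0 := by
  fin_cases x <;> fin_cases x' <;> fin_cases y <;> fin_cases y' <;>
    simp [bell, inv_sqrt_two_mul_self] <;> norm_num

lemma sum_normSq_bell (a b : Fin 2) : ∑ x, ∑ y, Complex.normSq (bell a b x y) = 1 := by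
  fin_cases a <;> fin_cases b <;> norm_num [bell, normSq_inv_sqrt_two]

/-- In each of the three bases, a Bell vector has two outcomes of probability `1 / 2`. -/
lemma normSq_bell_amplitude (t : Fin 3) (a b k k' : Fin 2) :
    Complex.normSq (∑ x, ∑ y, star (qubitUnitary t x k) * star (qubitUnitary t y k') *
      bell a b x y) = 0 ∨
    Complex.normSq (∑ x, ∑ y, star (qubitUnitary t x k) * star (qubitUnitary t y k') *
      bell a b x y) = 1 / 2 := by
  -- A real variable `r` for `1 / √2` makes amplitudes polynomial. The Bell vector gives one factor
  -- `r`, and the unitaries none or two, so the squared moduli involve only `r ^ 2` and `r ^ 6`.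
  have hc : ((√2 : ℝ) : ℂ)⁻¹ = ((√2)⁻¹ : ℝ) := by simp
  obtain ⟨r, hr⟩ : ∃ r : ℝ, r = (√2)⁻¹ := ⟨_, rfl⟩
  have h2 : r ^ 2 = 1 / 2 := by rw [hr, inv_pow, Real.sq_sqrt (by norm_num), one_div]
  have h6 : r ^ 6 = 1 / 8 := by rw [show r ^ 6 = (r ^ 2) ^ 3 by ring, h2]; norm_num
  simp only [qubitUnitary, hadamard, kMatrix, pauliX, bell, hc, ← hr]
  fin_cases t <;> fin_cases a <;> fin_cases b <;> fin_cases k <;> fin_cases k' <;>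
    simp [Complex.normSq_apply] <;> ring_nf <;> norm_num [h2, h6]

lemma isPOVM_bellMeasurement (hn : Even n) : IsPOVM (bellMeasurement n) := by
  refine ⟨fun _ => posSemidef_vecMulVec_self_star _, ?_⟩
  ext x y
  have h := sum_prod_pairs hn fun j a b =>
    bell a b (x ⟨2 * j, by omega⟩) (x ⟨2 * j + 1, by omega⟩) *
      star (bell a b (y ⟨2 * j, by omega⟩) (y ⟨2 * j + 1, by omega⟩))
  simp only [sum_bell_mul_star] at h
  rw [Matrix.sum_apply]
  simp only [bellMeasurement, vecMulVec_apply, bellVector, Pi.star_apply, star_prod,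
    ← Finset.prod_mul_distrib]
  rw [h, one_apply, Finset.prod_boole]
  congr 1
  refine propext ⟨fun hx => funext fun l => ?_, ?_⟩
  · obtain ⟨⟨j, b⟩, rfl⟩ := (qubitPairEquiv hn).surjective l
    have hj := hx j (Finset.mem_univ j)
    fin_cases b
    · exact hj.1
    · exact hj.2
  · rintro rfl
    simp

lemma normSqSum_bellVector (hn : Even n) (i : Bits n) : normSqSum (bellVector n i) = 1 := by
  simp only [normSqSum, bellVector, map_prod]
  have h := sum_prod_pairs hn fun j a b =>
    Complex.normSq (bell (i ⟨2 * j, by omega⟩) (i ⟨2 * j + 1, by omega⟩) a b)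
  rw [h]
  simp only [sum_normSq_bell, Finset.prod_const_one]

lemma averageEntropy_bellVector (hn : Even n) {p : Fin 3 → ℝ} (hp : ∑ t, p t = 1) (i : Bits n) :
    averageEntropy n p (bellVector n i) = n / 2 * log 2 := by
  have hamp : ∀ t k, ((basisUnitary n t)ᴴ *ᵥ bellVector n i) k =
      ∏ j : Fin (n / 2), ∑ x, ∑ y, star (qubitUnitary t x (k ⟨2 * j, by omega⟩)) *
        star (qubitUnitary t y (k ⟨2 * j + 1, by omega⟩)) *
        bell (i ⟨2 * j, by omega⟩) (i ⟨2 * j + 1, by omega⟩) x y := by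
    intro t k
    rw [← sum_prod_pairs hn]
    simp only [mulVec, dotProduct, conjTranspose_apply, basisUnitary_eq, tensorPow, of_apply,
      star_prod, star_mul', bellVector, prod_eq_prod_pairs hn, ← Finset.prod_mul_distrib]
  -- A product of `n / 2` factors, each 0 or `1/2`, is 0 or `(1/2) ^ (n / 2)`.
  have hflat : ∀ t k, basisDist (basisUnitary n t) (bellVector n i) k = 0 ∨
      basisDist (basisUnitary n t) (bellVector n i) k = (1 / 2) ^ (n / 2) := by
    intro t k
    rw [basisDist, hamp, map_prod]
    by_cases h : ∃ j : Fin (n / 2), Complex.normSq (∑ x, ∑ y,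
        star (qubitUnitary t x (k ⟨2 * j, by omega⟩)) *
        star (qubitUnitary t y (k ⟨2 * j + 1, by omega⟩)) *
        bell (i ⟨2 * j, by omega⟩) (i ⟨2 * j + 1, by omega⟩) x y) = 0
    · obtain ⟨j, hj⟩ := h
      exact Or.inl (Finset.prod_eq_zero (Finset.mem_univ j) hj)
    · push Not at h
      right
      rw [Finset.prod_congr rfl fun j _ => (normSq_bell_amplitude t _ _ _ _).resolve_left (h j)]
      simp
  have hG : ∀ t, massEntropy (basisDist (basisUnitary n t) (bellVector n i)) = n / 2 * log 2 := by
    intro t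
    rw [massEntropy_of_flat (hflat t)
      (by rw [sum_basisDist (basisUnitary_unitary n t), normSqSum_bellVector hn]),
      log_pow, one_div, log_inv, Nat.cast_div_charZero hn.two_dvd]
    push_cast
    ring
  simp only [averageEntropy, hG, ← Finset.sum_mul, hp, one_mul]

lemma mutualInfo_bellMeasurement (hn : Even n) {p : Fin 3 → ℝ} (hp : ∑ t, p t = 1) :
    mutualInfo (jointDist (ensemblePrior n p) (ensembleState n) (bellMeasurement n)) = n / 2 := by
  apply mul_left_cancel₀ (log_pos one_lt_two).ne'
  have h := log_two_mul_mutualInfo_vecMulVec hp (v := bellVector n) (isPOVM_bellMeasurement hn)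
  simp only [averageEntropy_bellVector hn hp, Finset.sum_const, Finset.card_univ, nsmul_eq_mul,
    card_bits] at h
  refine h.trans ?_
  field_simp
  ring

end bell

end Locking

theorem lemma3 (n : ℕ) (hn : Even n) (hpos : 0 < n) (p : Fin 3 → ℝ)
    (hp_nonneg : ∀ t, 0 ≤ p t) (hp_sum : ∑ t, p t = 1) :
    -- the maximum that defines the accessible information exists
    IsGreatest (Locking.attainableInfo (Locking.ensemblePrior n p) (Locking.ensembleState n))
      (Locking.accessibleInfo (Locking.ensemblePrior n p) (Locking.ensembleState n)) ∧
    ((∀ t, p t ≤ 1 / 2) →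
      Locking.accessibleInfo (Locking.ensemblePrior n p) (Locking.ensembleState n) = (n : ℝ) / 2 ∧
      Locking.IsPOVM (Locking.bellMeasurement n) ∧
      Locking.mutualInfo (Locking.jointDist (Locking.ensemblePrior n p) (Locking.ensembleState n)
        (Locking.bellMeasurement n)) = (n : ℝ) / 2) ∧
    ((∃ t, 1 / 2 < p t) →
      (n : ℝ) / 2 < Locking.accessibleInfo (Locking.ensemblePrior n p) (Locking.ensembleState n)) := by
  obtain ⟨φ, hφ, hmin, hmax⟩ :=
    Locking.exists_isGreatest_attainableInfo (n := n) hp_nonneg hp_sum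
  have hacc : Locking.accessibleInfo (Locking.ensemblePrior n p) (Locking.ensembleState n) =
      n - Locking.averageEntropy n p φ / Real.log 2 := hmax.csSup_eq
  have hl : 0 < Real.log 2 := Real.log_pos one_lt_two
  have hbell := Locking.mutualInfo_bellMeasurement hn hp_sum
  refine ⟨hacc ▸ hmax, fun hhalf => ⟨?_, Locking.isPOVM_bellMeasurement hn, hbell⟩, ?_⟩
  · apply le_antisymm
    · have h := Locking.half_le_averageEntropy hp_sum hhalf φ
      rw [hφ, mul_one, ← le_div_iff₀ hl] at h
      rw [hacc]
      linarith
    · rw [hacc, ← hbell]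
      exact hmax.2 (Locking.mutualInfo_mem_attainableInfo hp_sum
        (Locking.isPOVM_bellMeasurement hn))
  · rintro ⟨t, ht⟩
    obtain ⟨ψ, hψ, hle⟩ := Locking.exists_averageEntropy_le (n := n) hp_nonneg hp_sum t
    have h := hmin ψ
    rw [hψ, mul_one] at h
    have h' : Locking.averageEntropy n p φ / Real.log 2 ≤ (1 - p t) * n := by
      rw [div_le_iff₀ hl]
      linarith
    -- Positivity of `n` makes the final inequality strict.
    have hn' : (0 : ℝ) < n := by exact_mod_cast hpos
    have h2 : (1 - p t) * n < 1 / 2 * n := by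
      gcongr
      linarith
    rw [hacc]
    linarith
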